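/- **Setting.** Let $M$ be a smooth (Hausdorff) manifold without boundary, of dimension $2n+1$. An *almost paracontact paracomplex Riemannian structure* $(\phi,\xi,\eta,g)$ on $M$ consists of a smooth $(1,1)$-tensor field $\phi$, a smooth vector field $\xi$, a smooth $1$-form $\eta$ and a Riemannian metric $g$ such that $$\phi^2=\mathrm{id}-\eta\otimes\xi,\qquad \eta(\xi)=1,\qquad g(x,\xi)=\eta(x),\qquad g(\phi x,\phi y)=g(x,y)-\eta(x)\eta(y),$$ and such that on $H=\ker\eta$ the eigenspaces of $\phi$ for the eigenvalues $1$ and $-1$ both have dimension $n$ at every point. Let $\nabla$ be the Levi-Civita connection of $g$, and let $x,y,z$ denote smooth vector fields on $M$ and $X,Y,Z$ smooth vector fields with values in $H$. Put * $(\nabla_x\phi)y=\nabla_x(\phi y)-\phi(\nabla_xy)$ and $F(x,y,z)=g((\nabla_x\phi)y,z)$; * $\widetilde g(x,y)=g(x,\phi y)+\eta(x)\eta(y)$; * $N(x,y)=[\phi x,\phi y]+\phi^2[x,y]-\phi[\phi x,y]-\phi[x,\phi y]-\mathrm d\eta(x,y)\,\xi$, where $\mathrm d\eta(x,y)=x\,\eta(y)-y\,\eta(x)-\eta([x,y])$;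 * $\widehat N(x,y)=\{\phi x,\phi y\}+\phi^2\{x,y\}-\phi\{\phi x,y\}-\phi\{x,\phi y\}-(\mathcal L_\xi g)(x,y)\,\xi$, where $\{x,y\}=\nabla_xy+\nabla_yx$ and $\mathcal L$ is the Lie derivative. The manifold $(M,\phi,\xi,\eta,g)$ is called *para-Sasaki-like* if for all smooth horizontal $X,Y,Z$ $$F(X,Y,Z)=F(\xi,Y,Z)=F(\xi,\xi,Z)=0,\qquad F(X,Y,\xi)=-g(X,Y).$$ **Theorem.** For an almost paracontact paracomplex Riemannian manifold $(M,\phi,\xi,\eta,g)$ the following conditions are equivalent: (a) $(M,\phi,\xi,\eta,g)$ is para-Sasaki-like; (b) for all smooth vector fields $x,y$, $$(\nabla_x\phi)y=-g(x,y)\xi-\eta(y)x+2\eta(x)\eta(y)\xi=-g(\phi x,\phi y)\xi-\eta(y)\phi^2x;$$ (c) $N=0$ and $\widehat N=-4(\widetilde g-\eta\otimes\eta)\otimes\xi$. -/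

import Mathlib

open Bundle VectorField
open scoped Manifold ContDiff

noncomputable section

section LeviCivita

variable {E : Type*} [NormedAddCommGroup E] [NormedSpace ℝ E]
  {M : Type*} [TopologicalSpace M] [ChartedSpace E M]
  [RiemannianBundle (fun p : M => TangentSpace 𝓘(ℝ, E) p)]

/-- The function `p ↦ g(X, Y)(p)`, where `g` is the Riemannian metric of `M`. -/
def metricPairing (X Y : Π p : M, TangentSpace 𝓘(ℝ, E) p) (p : M) : ℝ :=
  inner ℝ (X p) (Y p)

/-- The function `p ↦ (X f)(p)`, the derivative of `f` in the direction of `X`. -/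
def dirDeriv (X : Π p : M, TangentSpace 𝓘(ℝ, E) p) (f : M → ℝ) (p : M) : ℝ :=
  mvfderiv 𝓘(ℝ, E) f p (X p)

/-- The right-hand side of the Koszul formula for `2 g(∇_X Y, Z)`. -/
def koszul (Y X Z : Π p : M, TangentSpace 𝓘(ℝ, E) p) (p : M) : ℝ :=
  dirDeriv X (metricPairing Y Z) p + dirDeriv Y (metricPairing Z X) p
    - dirDeriv Z (metricPairing X Y) p
    + metricPairing (mlieBracket 𝓘(ℝ, E) X Y) Z p
    + metricPairing (mlieBracket 𝓘(ℝ, E) Z X) Y p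
    + metricPairing (mlieBracket 𝓘(ℝ, E) Z Y) X p

lemma metricPairing_apply (X Y : Π p : M, TangentSpace 𝓘(ℝ, E) p) (p : M) :
    metricPairing X Y p = inner ℝ (X p) (Y p) := rfl

lemma metricPairing_comm (X Y : Π p : M, TangentSpace 𝓘(ℝ, E) p) :
    metricPairing X Y = metricPairing Y X := by
  ext p; exact real_inner_comm _ _

lemma metricPairing_add (X X' Y : Π p : M, TangentSpace 𝓘(ℝ, E) p) :
    metricPairing (X + X') Y = metricPairing X Y + metricPairing X' Y := by
  ext p; exact inner_add_left _ _ _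

lemma metricPairing_smul (f : M → ℝ) (X Y : Π p : M, TangentSpace 𝓘(ℝ, E) p) :
    metricPairing (f • X) Y = f * metricPairing X Y := by
  ext p; exact real_inner_smul_left _ _ _

variable [IsManifold 𝓘(ℝ, E) ∞ M] [FiniteDimensional ℝ E]
  [IsContMDiffRiemannianBundle 𝓘(ℝ, E) ∞ E (fun p : M => TangentSpace 𝓘(ℝ, E) p)]

lemma mdifferentiableAt_metricPairing {X Y : Π p : M, TangentSpace 𝓘(ℝ, E) p} {p : M}
    (hX : MDiffAt (T% X) p) (hY : MDiffAt (T% Y) p) : MDiffAt (metricPairing X Y) p :=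
  MDifferentiableAt.inner_bundle (IB := 𝓘(ℝ, E)) (IM := 𝓘(ℝ, E)) (F := E)
    (E := fun p : M => TangentSpace 𝓘(ℝ, E) p) (b := fun p => p) hX hY

lemma tensorialAt_koszul_right {X Y : Π p : M, TangentSpace 𝓘(ℝ, E) p} {p : M}
    (hX : MDiffAt (T% X) p) (hY : MDiffAt (T% Y) p) :
    TensorialAt 𝓘(ℝ, E) E (fun Z => koszul Y X Z p) p where
  smul {f Z} hf hZ := by
    have hZY := mdifferentiableAt_metricPairing hZ hY
    have hZX := mdifferentiableAt_metricPairing hZ hX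
    simp only [koszul, metricPairing_comm Y (f • Z), metricPairing_comm Y Z, metricPairing_smul,
      dirDeriv, mvfderiv_mul hf hZY, mvfderiv_mul hf hZX, metricPairing_apply, Pi.smul_apply',
      mlieBracket_smul_left hf hZ, inner_add_left, inner_smul_left, inner_smul_right, map_smul]
    simp [real_inner_comm]
    ring
  add {Z Z'} hZ hZ' := by
    have hZY := mdifferentiableAt_metricPairing hZ hY
    have hZX := mdifferentiableAt_metricPairing hZ hX
    have hZY' := mdifferentiableAt_metricPairing hZ' hY
    have hZX' := mdifferentiableAt_metricPairing hZ' hX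
    simp only [koszul, metricPairing_comm Y, metricPairing_add,
      dirDeriv, mvfderiv_add hZY hZY', mvfderiv_add hZX hZX', metricPairing_apply, Pi.add_apply,
      mlieBracket_add_left hZ hZ', inner_add_left, inner_add_right, map_add]
    simp
    ring

lemma tensorialAt_koszul_left {Y Z : Π p : M, TangentSpace 𝓘(ℝ, E) p} {p : M}
    (hY : MDiffAt (T% Y) p) (hZ : MDiffAt (T% Z) p) :
    TensorialAt 𝓘(ℝ, E) E (fun X => koszul Y X Z p) p where
  smul {f X} hf hX := by
    have hXY := mdifferentiableAt_metricPairing hX hY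
    have hXZ := mdifferentiableAt_metricPairing hX hZ
    simp only [koszul, metricPairing_comm Z (f • X), metricPairing_comm Z X, metricPairing_smul,
      dirDeriv, mvfderiv_mul hf hXY, mvfderiv_mul hf hXZ, metricPairing_apply, Pi.smul_apply',
      mlieBracket_smul_left hf hX, mlieBracket_smul_right hf hX, inner_add_left, inner_smul_left,
      inner_smul_right, map_smul]
    simp [real_inner_comm]
    ring
  add {X X'} hX hX' := by
    have hXY := mdifferentiableAt_metricPairing hX hY
    have hXZ := mdifferentiableAt_metricPairing hX hZ
    have hXY' := mdifferentiableAt_metricPairing hX' hY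
    have hXZ' := mdifferentiableAt_metricPairing hX' hZ
    simp only [koszul, metricPairing_comm Z, metricPairing_add,
      dirDeriv, mvfderiv_add hXY hXY', mvfderiv_add hXZ hXZ', metricPairing_apply, Pi.add_apply,
      mlieBracket_add_left hX hX', mlieBracket_add_right hX hX', inner_add_left, inner_add_right,
      map_add]
    simp
    ring

lemma koszul_add {X Y Y' Z : Π p : M, TangentSpace 𝓘(ℝ, E) p} {p : M}
    (hX : MDiffAt (T% X) p) (hY : MDiffAt (T% Y) p) (hY' : MDiffAt (T% Y') p)
    (hZ : MDiffAt (T% Z) p) :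
    koszul (Y + Y') X Z p = koszul Y X Z p + koszul Y' X Z p := by
  have h1 := mdifferentiableAt_metricPairing hY hX
  have h1' := mdifferentiableAt_metricPairing hY' hX
  have h2 := mdifferentiableAt_metricPairing hY hZ
  have h2' := mdifferentiableAt_metricPairing hY' hZ
  simp only [koszul, metricPairing_comm X, metricPairing_add,
    dirDeriv, mvfderiv_add h1 h1', mvfderiv_add h2 h2', metricPairing_apply, Pi.add_apply,
    mlieBracket_add_right hY hY', inner_add_left, inner_add_right, map_add]
  simp
  ring

lemma koszul_smul {X Y Z : Π p : M, TangentSpace 𝓘(ℝ, E) p} {f : M → ℝ} {p : M}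
    (hf : MDiffAt f p) (hX : MDiffAt (T% X) p) (hY : MDiffAt (T% Y) p) (hZ : MDiffAt (T% Z) p) :
    koszul (f • Y) X Z p
      = f p * koszul Y X Z p + 2 * (dirDeriv X f p * metricPairing Y Z p) := by
  have h1 := mdifferentiableAt_metricPairing hY hX
  have h2 := mdifferentiableAt_metricPairing hY hZ
  simp only [koszul, metricPairing_comm X (f • Y), metricPairing_comm X Y, metricPairing_smul,
    dirDeriv, mvfderiv_mul hf h1, mvfderiv_mul hf h2, metricPairing_apply, Pi.smul_apply',
    mlieBracket_smul_right hf hY, inner_add_left, inner_smul_left,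
    inner_smul_right, map_smul]
  simp [real_inner_comm]
  ring

open Classical in
/-- The vector `∇_v Y` at `p`: for `Y` differentiable at `p` it is determined by the Koszul formula
`2 g(∇_X Y, Z) = koszul Y X Z`. -/
def leviCivitaAt (Y : Π p : M, TangentSpace 𝓘(ℝ, E) p) (p : M) :
    TangentSpace 𝓘(ℝ, E) p →L[ℝ] TangentSpace 𝓘(ℝ, E) p :=
  haveI : FiniteDimensional ℝ (TangentSpace 𝓘(ℝ, E) p) := inferInstanceAs (FiniteDimensional ℝ E)
  haveI : CompleteSpace (TangentSpace 𝓘(ℝ, E) p) := FiniteDimensional.complete ℝ _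
  if hY : MDiffAt (T% Y) p then
    LinearMap.toContinuousLinearMap
      { toFun := fun v => (InnerProductSpace.toDual ℝ (TangentSpace 𝓘(ℝ, E) p)).symm
          ((1 / 2 : ℝ) • TensorialAt.mkHom₂ (fun X Z => koszul Y X Z p) p
            (fun _ hZ => tensorialAt_koszul_left hY hZ)
            (fun _ hX => tensorialAt_koszul_right hX hY) v)
        map_add' := fun v w => by rw [map_add, smul_add, map_add]
        map_smul' := fun c v => by
          
          rw [ContinuousLinearMap.map_smul, smul_comm, LinearIsometryEquiv.map_smulₛₗ]; rfl }
  else 0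

lemma two_mul_inner_leviCivitaAt {X Y Z : Π p : M, TangentSpace 𝓘(ℝ, E) p} {p : M}
    (hX : MDiffAt (T% X) p) (hY : MDiffAt (T% Y) p) (hZ : MDiffAt (T% Z) p) :
    2 * inner ℝ (leviCivitaAt Y p (X p)) (Z p) = koszul Y X Z p := by
  have h := TensorialAt.mkHom₂_apply (fun _ hZ => tensorialAt_koszul_left hY hZ)
    (fun _ hX => tensorialAt_koszul_right hX hY) hX hZ
  have : FiniteDimensional ℝ (TangentSpace 𝓘(ℝ, E) p) := inferInstanceAs (FiniteDimensional ℝ E)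
  have : CompleteSpace (TangentSpace 𝓘(ℝ, E) p) := FiniteDimensional.complete ℝ _
  simp only [leviCivitaAt, dif_pos hY]
  change 2 * inner ℝ ((InnerProductSpace.toDual ℝ (TangentSpace 𝓘(ℝ, E) p)).symm _) (Z p) = _
  rw [InnerProductSpace.toDual_symm_apply, ← h]
  simp only [_root_.smul_apply, smul_eq_mul]
  ring

/-- Two endomorphisms of a tangent space agree if they agree after pairing with the values of
differentiable vector fields. -/
lemma tangent_clm_ext {p : M}
    {A B : TangentSpace 𝓘(ℝ, E) p →L[ℝ] TangentSpace 𝓘(ℝ, E) p}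
    (h : ∀ X Z : Π p : M, TangentSpace 𝓘(ℝ, E) p, MDiffAt (T% X) p → MDiffAt (T% Z) p →
      2 * inner ℝ (A (X p)) (Z p) = 2 * inner ℝ (B (X p)) (Z p)) : A = B := by
  ext v
  refine ext_inner_right ℝ fun w => ?_
  have := h (FiberBundle.extend E v) (FiberBundle.extend E w)
    (FiberBundle.mdifferentiableAt_extend ..) (FiberBundle.mdifferentiableAt_extend ..)
  simpa using this

/-- The Levi-Civita connection of the Riemannian metric of `M`: `leviCivita Y p v` is `∇_v Y`. -/
def leviCivita : CovariantDerivative 𝓘(ℝ, E) E (fun p : M => TangentSpace 𝓘(ℝ, E) p) where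
  toFun := leviCivitaAt
  isCovariantDerivativeOnUniv :=
    { add := fun {Y Y' p} hY hY' _ => tangent_clm_ext fun X Z hX hZ => by
        rw [two_mul_inner_leviCivitaAt hX (mdifferentiableAt_add_section hY hY') hZ,
          koszul_add hX hY hY' hZ, ← two_mul_inner_leviCivitaAt hX hY hZ,
          ← two_mul_inner_leviCivitaAt hX hY' hZ, _root_.add_apply, inner_add_left]
        ring
      leibniz := fun {Y f p} hY hf _ => tangent_clm_ext fun X Z hX hZ => by
        rw [two_mul_inner_leviCivitaAt hX (hf.smul_section hY) hZ,
          koszul_smul hf hX hY hZ, ← two_mul_inner_leviCivitaAt hX hY hZ,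
          _root_.add_apply, inner_add_left, _root_.smul_apply,
          ContinuousLinearMap.smulRight_apply, real_inner_smul_left, real_inner_smul_left,
          dirDeriv, metricPairing]
        ring }

theorem leviCivita_isMetricCompatible :
    CovariantDerivative.IsMetricCompatible (V := fun p : M => TangentSpace 𝓘(ℝ, E) p)
      leviCivita := by
  rw [CovariantDerivative.isMetricCompatible_iff]
  intro p X Y Z hX hY hZ
  have h1 := two_mul_inner_leviCivitaAt hX hY hZ
  have h2 := two_mul_inner_leviCivitaAt hX hZ hY
  rw [real_inner_comm] at h2
  have e1 : mlieBracket 𝓘(ℝ, E) Z Y p = - mlieBracket 𝓘(ℝ, E) Y Z p := mlieBracket_swap_apply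
  have e2 : mlieBracket 𝓘(ℝ, E) Z X p = - mlieBracket 𝓘(ℝ, E) X Z p := mlieBracket_swap_apply
  have e3 : mlieBracket 𝓘(ℝ, E) Y X p = - mlieBracket 𝓘(ℝ, E) X Y p := mlieBracket_swap_apply
  simp only [koszul, metricPairing_comm Z Y, metricPairing_comm Z X, metricPairing_comm Y X] at h1 h2
  simp only [metricPairing_apply, e1, e2, e3, inner_neg_left] at h1 h2
  change dirDeriv X (metricPairing Y Z) p = inner ℝ (leviCivitaAt Y p (X p)) (Z p)
    + inner ℝ (Y p) (leviCivitaAt Z p (X p))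
  linarith

theorem leviCivita_torsion_eq_zero :
    (leviCivita : CovariantDerivative 𝓘(ℝ, E) E
      (fun p : M => TangentSpace 𝓘(ℝ, E) p)).torsion = 0 := by
  rw [CovariantDerivative.torsion_eq_zero_iff]
  intro X Y p hX hY
  refine ext_inner_right ℝ fun w => ?_
  obtain ⟨Z, hZ, rfl⟩ : ∃ Z : Π p : M, TangentSpace 𝓘(ℝ, E) p, MDiffAt (T% Z) p ∧ Z p = w :=
    ⟨FiberBundle.extend E w, FiberBundle.mdifferentiableAt_extend .., by simp⟩
  have h1 := two_mul_inner_leviCivitaAt hX hY hZ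
  have h2 := two_mul_inner_leviCivitaAt hY hX hZ
  have e3 : mlieBracket 𝓘(ℝ, E) Y X p = - mlieBracket 𝓘(ℝ, E) X Y p := mlieBracket_swap_apply
  simp only [koszul, metricPairing_comm Z Y, metricPairing_comm Z X, metricPairing_comm Y X] at h1 h2
  simp only [metricPairing_apply, e3, inner_neg_left] at h1 h2
  change inner ℝ (leviCivitaAt Y p (X p) - leviCivitaAt X p (Y p)) (Z p) = _
  rw [inner_sub_left]
  linarith

end LeviCivita

section ParacontactParacomplex

/-- An almost paracontact paracomplex Riemannian structure `(φ, ξ, η, g)` on a smooth manifold `M`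
with Riemannian metric `g`: a smooth `(1,1)`-tensor field `φ`, a smooth vector field `ξ` and a smooth
`1`-form `η`, such that the eigenspaces of `φ` on `ker η` for the eigenvalues `1` and `-1` have
dimension `n`, and `g` is compatible with `(φ, ξ, η)`. -/
structure ParacontactParacomplexStructure
    (E : Type*) [NormedAddCommGroup E] [NormedSpace ℝ E]
    (M : Type*) [TopologicalSpace M] [ChartedSpace E M] [IsManifold 𝓘(ℝ, E) ∞ M]
    [RiemannianBundle (fun p : M => TangentSpace 𝓘(ℝ, E) p)] (n : ℕ) where
  phi : Π p : M, TangentSpace 𝓘(ℝ, E) p →L[ℝ] TangentSpace 𝓘(ℝ, E) p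
  xi : Π p : M, TangentSpace 𝓘(ℝ, E) p
  eta : Π p : M, TangentSpace 𝓘(ℝ, E) p →L[ℝ] ℝ
  contMDiff_phi : ContMDiff 𝓘(ℝ, E) (𝓘(ℝ, E).prod 𝓘(ℝ, E →L[ℝ] E)) ∞
    (fun p => TotalSpace.mk' (E →L[ℝ] E)
      (E := fun p : M => TangentSpace 𝓘(ℝ, E) p →L[ℝ] TangentSpace 𝓘(ℝ, E) p) p (phi p))
  contMDiff_xi : ContMDiff 𝓘(ℝ, E) (𝓘(ℝ, E).prod 𝓘(ℝ, E)) ∞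
    (fun p => TotalSpace.mk' E (E := fun p : M => TangentSpace 𝓘(ℝ, E) p) p (xi p))
  contMDiff_eta : ContMDiff 𝓘(ℝ, E) (𝓘(ℝ, E).prod 𝓘(ℝ, E →L[ℝ] ℝ)) ∞
    (fun p => TotalSpace.mk' (E →L[ℝ] ℝ)
      (E := fun p : M => TangentSpace 𝓘(ℝ, E) p →L[ℝ] Bundle.Trivial M ℝ p) p (eta p))
  phi_phi : ∀ (p : M) (v : TangentSpace 𝓘(ℝ, E) p), phi p (phi p v) = v - eta p v • xi p
  eta_xi : ∀ p : M, eta p (xi p) = 1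
  finrank_eigenspace_one : ∀ p : M, Module.finrank ℝ
    ↥((eta p).ker ⊓ Module.End.eigenspace (phi p).toLinearMap 1) = n
  finrank_eigenspace_neg_one : ∀ p : M, Module.finrank ℝ
    ↥((eta p).ker ⊓ Module.End.eigenspace (phi p).toLinearMap (-1)) = n
  inner_xi : ∀ (p : M) (v : TangentSpace 𝓘(ℝ, E) p), inner ℝ v (xi p) = eta p v
  inner_phi_phi : ∀ (p : M) (v w : TangentSpace 𝓘(ℝ, E) p),
    inner ℝ (phi p v) (phi p w) = inner ℝ v w - eta p v * eta p w

/-- Smooth vector fields on `M`. -/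
def IsSmoothVectorField {E : Type*} [NormedAddCommGroup E] [NormedSpace ℝ E]
    {M : Type*} [TopologicalSpace M] [ChartedSpace E M] [IsManifold 𝓘(ℝ, E) ∞ M]
    (X : Π p : M, TangentSpace 𝓘(ℝ, E) p) : Prop :=
  ContMDiff 𝓘(ℝ, E) (𝓘(ℝ, E).prod 𝓘(ℝ, E)) ∞
    (fun p => TotalSpace.mk' E (E := fun p : M => TangentSpace 𝓘(ℝ, E) p) p (X p))

namespace ParacontactParacomplexStructure

variable {E : Type*} [NormedAddCommGroup E] [NormedSpace ℝ E]
  {M : Type*} [TopologicalSpace M] [ChartedSpace E M] [IsManifold 𝓘(ℝ, E) ∞ M]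
  [RiemannianBundle (fun p : M => TangentSpace 𝓘(ℝ, E) p)] {n : ℕ}

/-- The vector field `φX`. -/
def phiField (S : ParacontactParacomplexStructure E M n) (X : Π p : M, TangentSpace 𝓘(ℝ, E) p) :
    Π p : M, TangentSpace 𝓘(ℝ, E) p :=
  fun p => S.phi p (X p)

/-- The function `η(X)`. -/
def etaFun (S : ParacontactParacomplexStructure E M n) (X : Π p : M, TangentSpace 𝓘(ℝ, E) p) :
    M → ℝ :=
  fun p => S.eta p (X p)

/-- Smooth sections of the paracontact distribution `ker η`. -/
def IsSmoothHorizontal (S : ParacontactParacomplexStructure E M n)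
    (X : Π p : M, TangentSpace 𝓘(ℝ, E) p) : Prop :=
  IsSmoothVectorField X ∧ ∀ p, S.eta p (X p) = 0

/-- The associated metric `g̃(X, Y) = g(X, φY) + η(X) η(Y)`. -/
def assocMetric (S : ParacontactParacomplexStructure E M n)
    (X Y : Π p : M, TangentSpace 𝓘(ℝ, E) p) (p : M) : ℝ :=
  inner ℝ (X p) (S.phiField Y p) + S.etaFun X p * S.etaFun Y p

/-- `dη(X, Y) = X η(Y) - Y η(X) - η([X, Y])`. -/
def dEta (S : ParacontactParacomplexStructure E M n)
    (X Y : Π p : M, TangentSpace 𝓘(ℝ, E) p) (p : M) : ℝ :=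
  dirDeriv X (S.etaFun Y) p - dirDeriv Y (S.etaFun X) p
    - S.etaFun (mlieBracket 𝓘(ℝ, E) X Y) p

/-- `(𝓛_ξ g)(X, Y) = ξ g(X, Y) - g([ξ, X], Y) - g(X, [ξ, Y])`. -/
def lieDerivMetric (S : ParacontactParacomplexStructure E M n)
    (X Y : Π p : M, TangentSpace 𝓘(ℝ, E) p) (p : M) : ℝ :=
  dirDeriv S.xi (metricPairing X Y) p - metricPairing (mlieBracket 𝓘(ℝ, E) S.xi X) Y p
    - metricPairing X (mlieBracket 𝓘(ℝ, E) S.xi Y) p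

/-- The Nijenhuis tensor `N = [φ, φ] - dη ⊗ ξ`, where
`[φ, φ](X, Y) = [φX, φY] + φ²[X, Y] - φ[φX, Y] - φ[X, φY]`. -/
def nijenhuis (S : ParacontactParacomplexStructure E M n)
    (X Y : Π p : M, TangentSpace 𝓘(ℝ, E) p) (p : M) : TangentSpace 𝓘(ℝ, E) p :=
  mlieBracket 𝓘(ℝ, E) (S.phiField X) (S.phiField Y) p
    + S.phi p (S.phi p (mlieBracket 𝓘(ℝ, E) X Y p))
    - S.phi p (mlieBracket 𝓘(ℝ, E) (S.phiField X) Y p)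
    - S.phi p (mlieBracket 𝓘(ℝ, E) X (S.phiField Y) p)
    - S.dEta X Y p • S.xi p

variable [FiniteDimensional ℝ E]
  [IsContMDiffRiemannianBundle 𝓘(ℝ, E) ∞ E (fun p : M => TangentSpace 𝓘(ℝ, E) p)]

/-- `(∇_X φ) Y = ∇_X (φY) - φ (∇_X Y)`. -/
def nablaPhi (S : ParacontactParacomplexStructure E M n)
    (X Y : Π p : M, TangentSpace 𝓘(ℝ, E) p) (p : M) : TangentSpace 𝓘(ℝ, E) p :=
  leviCivita (S.phiField Y) p (X p) - S.phi p (leviCivita Y p (X p))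

/-- The structure tensor `F(X, Y, Z) = g((∇_X φ) Y, Z)`. -/
def F (S : ParacontactParacomplexStructure E M n)
    (X Y Z : Π p : M, TangentSpace 𝓘(ℝ, E) p) (p : M) : ℝ :=
  inner ℝ (S.nablaPhi X Y p) (Z p)

/-- The symmetric bracket `{X, Y} = ∇_X Y + ∇_Y X`. -/
def symBracket (X Y : Π p : M, TangentSpace 𝓘(ℝ, E) p) (p : M) : TangentSpace 𝓘(ℝ, E) p :=
  leviCivita Y p (X p) + leviCivita X p (Y p)

/-- The associated Nijenhuis tensor `N̂ = {φ, φ} - (𝓛_ξ g) ⊗ ξ`, where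
`{φ, φ}(X, Y) = {φX, φY} + φ²{X, Y} - φ{φX, Y} - φ{X, φY}`. -/
def assocNijenhuis (S : ParacontactParacomplexStructure E M n)
    (X Y : Π p : M, TangentSpace 𝓘(ℝ, E) p) (p : M) : TangentSpace 𝓘(ℝ, E) p :=
  symBracket (S.phiField X) (S.phiField Y) p
    + S.phi p (S.phi p (symBracket X Y p))
    - S.phi p (symBracket (S.phiField X) Y p)
    - S.phi p (symBracket X (S.phiField Y) p)
    - S.lieDerivMetric X Y p • S.xi p

/-- The para-Sasaki-like condition: for horizontal `X, Y, Z`,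
`F(X, Y, Z) = F(ξ, Y, Z) = F(ξ, ξ, Z) = 0` and `F(X, Y, ξ) = -g(X, Y)`. -/
def IsParaSasakiLike (S : ParacontactParacomplexStructure E M n) : Prop :=
  ∀ X Y Z : Π p : M, TangentSpace 𝓘(ℝ, E) p,
    S.IsSmoothHorizontal X → S.IsSmoothHorizontal Y → S.IsSmoothHorizontal Z →
    ∀ p : M, S.F X Y Z p = 0 ∧ S.F S.xi Y Z p = 0 ∧ S.F S.xi S.xi Z p = 0 ∧
      S.F X Y S.xi p = -inner ℝ (X p) (Y p)

end ParacontactParacomplexStructure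

end ParacontactParacomplex

end

/-!
Torsion-freeness and metric compatibility of `∇` reduce every condition to algebra in `∇φ` and `∇ξ`.
As `φ` is `g`-self-adjoint with `φ ξ = 0` and `η ∘ φ = 0`, the tensor `F(x, y, z)` is symmetric in
`y, z` (`F_comm`), vanishes for `y = z = ξ`, changes sign when `φ` is moved from `y` to `z`, both
horizontal (`F_phiField`), and satisfies `(∇_x φ) ξ = -φ (∇_x ξ)` (`nablaPhi_xi`).

* The components of `F` prescribed by the para-Sasaki-like condition are, by this symmetry, all its
  components in the splitting of the tangent spaces into `ker η` and `ℝ ξ`; hence the condition is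
  equivalent to the formula for `∇φ`. To conclude from global test fields, tangent vectors are
  extended by bump functions, which is where the Hausdorff property enters
  (`exists_isSmoothVectorField_eq`).
* `N` and `N̂` are twice the alternating and the symmetric part of
  `T(x, y) = (∇_{φx} φ) y - φ (∇_x φ) y - (∇_x η)(y) ξ` (`nijenhuis_eq`, `assocNijenhuis_eq`), so the
  conditions on `N` and `N̂` together say that `T(x, y) = -2 g(x, φy) ξ`. The formula for `∇φ` gives
  `∇_x ξ = φ x` and then this identity.
* Conversely, the identity for `T` at `x = ξ`, where `∇_{φξ} φ = 0`, kills `F(ξ, ·, ·)`. For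
  horizontal arguments it reads `F(φx, y, z) = F(x, y, φz)`. Evaluating `F(φx, y, φz)` as it stands
  gives `F(x, y, z)`, and with its last two arguments exchanged gives
  `F(x, φz, φy) = -F(x, z, y)`, so `F(x, y, z) = 0`. Pairing with
  `ξ`, and separately setting `y = ξ`, gives two expressions for `F(φx, φy, ξ)`, whose comparison
  yields `F(x, y, ξ) = -g(x, y)`.
-/

/-! ### Smooth vector fields -/

section SmoothVectorFields

variable {E : Type*} [NormedAddCommGroup E] [NormedSpace ℝ E]
  {M : Type*} [TopologicalSpace M] [ChartedSpace E M] [IsManifold 𝓘(ℝ, E) ∞ M]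
  {X Y : Π p : M, TangentSpace 𝓘(ℝ, E) p}

namespace IsSmoothVectorField

lemma mdiffAt (hX : IsSmoothVectorField X) (p : M) : MDiffAt (T% X) p :=
  (hX p).mdifferentiableAt (by simp)

lemma sub (hX : IsSmoothVectorField X) (hY : IsSmoothVectorField Y) :
    IsSmoothVectorField (X - Y) :=
  ContMDiff.sub_section hX hY

lemma smul {f : M → ℝ} (hf : ContMDiff 𝓘(ℝ, E) 𝓘(ℝ, ℝ) ∞ f) (hX : IsSmoothVectorField X) :
    IsSmoothVectorField (f • X) :=
  ContMDiff.smul_section hf hX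

end IsSmoothVectorField

/-- On a Hausdorff manifold every tangent vector is the value of a global smooth vector field:
cut off a local extension by a bump function. -/
lemma exists_isSmoothVectorField_eq [FiniteDimensional ℝ E] [T2Space M] {p : M}
    (v : TangentSpace 𝓘(ℝ, E) p) :
    ∃ X : Π p : M, TangentSpace 𝓘(ℝ, E) p, IsSmoothVectorField X ∧ X p = v := by
  obtain ⟨s, hs, hX⟩ := FiberBundle.exists_contMDiffOn_extend (k := ∞) 𝓘(ℝ, E) E v
  obtain ⟨u, hus, hu, hpu⟩ := mem_nhds_iff.1 hs
  obtain ⟨f, -, hf⟩ := (SmoothBumpFunction.nhds_basis_tsupport (I := 𝓘(ℝ, E)) p).mem_iff.1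
    (hu.mem_nhds hpu)
  refine ⟨(f : M → ℝ) • FiberBundle.extend E v,
    ContMDiffOn.smul_section_of_tsupport f.contMDiff.contMDiffOn hu hf (hX.mono hus), ?_⟩
  simp

end SmoothVectorFields

/-! ### The Levi-Civita connection on smooth fields -/

section LeviCivita

variable {E : Type*} [NormedAddCommGroup E] [NormedSpace ℝ E] [FiniteDimensional ℝ E]
  {M : Type*} [TopologicalSpace M] [ChartedSpace E M] [IsManifold 𝓘(ℝ, E) ∞ M]
  [RiemannianBundle (fun p : M => TangentSpace 𝓘(ℝ, E) p)]
  [IsContMDiffRiemannianBundle 𝓘(ℝ, E) ∞ E (fun p : M => TangentSpace 𝓘(ℝ, E) p)]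
  {X Y Z : Π p : M, TangentSpace 𝓘(ℝ, E) p}

lemma dirDeriv_metricPairing (X : Π p : M, TangentSpace 𝓘(ℝ, E) p) (hY : IsSmoothVectorField Y)
    (hZ : IsSmoothVectorField Z) (p : M) :
    dirDeriv X (metricPairing Y Z) p
      = inner ℝ (leviCivita Y p (X p)) (Z p) + inner ℝ (Y p) (leviCivita Z p (X p)) :=
  leviCivita_isMetricCompatible.mvfderiv_inner_eq X (hY.mdiffAt p) (hZ.mdiffAt p)

lemma mlieBracket_eq_leviCivita (hX : IsSmoothVectorField X) (hY : IsSmoothVectorField Y) (p : M) :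
    mlieBracket 𝓘(ℝ, E) X Y p = leviCivita Y p (X p) - leviCivita X p (Y p) :=
  ((CovariantDerivative.torsion_eq_zero_iff _).1 leviCivita_torsion_eq_zero
    (hX.mdiffAt p) (hY.mdiffAt p)).symm

end LeviCivita

/-! ### Pointwise algebra of the structure and the horizontal splitting -/

namespace ParacontactParacomplexStructure

variable {E : Type*} [NormedAddCommGroup E] [NormedSpace ℝ E]
  {M : Type*} [TopologicalSpace M] [ChartedSpace E M] [IsManifold 𝓘(ℝ, E) ∞ M]
  [RiemannianBundle (fun p : M => TangentSpace 𝓘(ℝ, E) p)] {n : ℕ}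
  (S : ParacontactParacomplexStructure E M n)

section Pointwise

variable {p : M}

lemma inner_xi_left (v : TangentSpace 𝓘(ℝ, E) p) : inner ℝ (S.xi p) v = S.eta p v := by
  rw [real_inner_comm, S.inner_xi]

lemma phi_xi (p : M) : S.phi p (S.xi p) = 0 := by
  have h := S.inner_phi_phi p (S.xi p) (S.xi p)
  rw [S.inner_xi, S.eta_xi, mul_one, sub_self] at h
  exact inner_self_eq_zero.1 h

lemma eta_phi (v : TangentSpace 𝓘(ℝ, E) p) : S.eta p (S.phi p v) = 0 := by
  -- Compare the two ways of grouping `φ³ v`.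
  have h := S.phi_phi p (S.phi p v)
  rw [S.phi_phi p v, map_sub, map_smul, S.phi_xi, smul_zero, sub_zero, eq_comm, sub_eq_self] at h
  have := congrArg (S.eta p) h
  simpa [S.eta_xi] using this

lemma inner_phi_left (v w : TangentSpace 𝓘(ℝ, E) p) :
    inner ℝ (S.phi p v) w = inner ℝ v (S.phi p w) := by
  have h := S.inner_phi_phi p v (S.phi p w)
  rw [S.phi_phi p w, S.eta_phi, mul_zero, sub_zero, inner_sub_right, real_inner_smul_right,
    S.inner_xi, S.eta_phi, mul_zero, sub_zero] at h
  exact h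

end Pointwise

section Fields

variable {S} {X Y Z : Π p : M, TangentSpace 𝓘(ℝ, E) p}

lemma isSmooth_xi : IsSmoothVectorField S.xi := S.contMDiff_xi

lemma isSmooth_phiField (hX : IsSmoothVectorField X) : IsSmoothVectorField (S.phiField X) :=
  ContMDiff.clm_bundle_apply (F₁ := E) (F₂ := E) S.contMDiff_phi hX

lemma contMDiff_etaFun (hX : IsSmoothVectorField X) :
    ContMDiff 𝓘(ℝ, E) 𝓘(ℝ, ℝ) ∞ (S.etaFun X) := by
  have h := ContMDiff.clm_bundle_apply (F₁ := E) (F₂ := ℝ) (E₂ := Bundle.Trivial M ℝ)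
    S.contMDiff_eta hX
  intro p
  exact (contMDiffAt_totalSpace.1 (h p)).2

lemma phiField_xi : S.phiField S.xi = 0 := funext S.phi_xi

variable (S) in
/-- The horizontal part `X - η(X) ξ` of a vector field. -/
noncomputable def horPart (X : Π p : M, TangentSpace 𝓘(ℝ, E) p) : Π p : M, TangentSpace 𝓘(ℝ, E) p :=
  X - S.etaFun X • S.xi

lemma horPart_apply (p : M) : S.horPart X p = X p - S.eta p (X p) • S.xi p := rfl

lemma inner_horPart (X Y : Π p : M, TangentSpace 𝓘(ℝ, E) p) (p : M) :
    inner ℝ (S.horPart X p) (S.horPart Y p)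
      = inner ℝ (X p) (Y p) - S.eta p (X p) * S.eta p (Y p) := by
  simp only [horPart_apply, inner_sub_left, inner_sub_right, real_inner_smul_left,
    real_inner_smul_right, S.inner_xi, S.inner_xi_left, S.eta_xi, map_smul, smul_eq_mul]
  ring

lemma isSmoothHorizontal_horPart (hX : IsSmoothVectorField X) :
    S.IsSmoothHorizontal (S.horPart X) :=
  ⟨hX.sub (isSmooth_xi.smul (contMDiff_etaFun hX)), fun p => by
    simp [horPart_apply, S.eta_xi]⟩

lemma IsSmoothHorizontal.phiField (hX : S.IsSmoothHorizontal X) :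
    S.IsSmoothHorizontal (S.phiField X) :=
  ⟨isSmooth_phiField hX.1, fun _ => S.eta_phi _⟩

lemma IsSmoothHorizontal.phiField_phiField (hX : S.IsSmoothHorizontal X) :
    S.phiField (S.phiField X) = X := by
  ext1 p
  simp [ParacontactParacomplexStructure.phiField, S.phi_phi, hX.2 p]

end Fields

/-! ### The covariant derivatives of `φ`, `ξ`, `η` and the Nijenhuis tensors -/

section CovariantDerivatives

variable [FiniteDimensional ℝ E]
  [IsContMDiffRiemannianBundle 𝓘(ℝ, E) ∞ E (fun p : M => TangentSpace 𝓘(ℝ, E) p)]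
  {S} {X Y Z : Π p : M, TangentSpace 𝓘(ℝ, E) p}

lemma nablaPhi_xi (X : Π p : M, TangentSpace 𝓘(ℝ, E) p) (p : M) :
    S.nablaPhi X S.xi p = -S.phi p (leviCivita S.xi p (X p)) := by
  simp [nablaPhi, phiField_xi]

lemma eta_leviCivita_xi (X : Π p : M, TangentSpace 𝓘(ℝ, E) p) (p : M) :
    S.eta p (leviCivita S.xi p (X p)) = 0 := by
  have h := dirDeriv_metricPairing X S.isSmooth_xi S.isSmooth_xi p
  have hc : metricPairing S.xi S.xi = fun _ : M => (1 : ℝ) := by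
    ext q; rw [metricPairing_apply, S.inner_xi, S.eta_xi]
  have h0 : dirDeriv X (fun _ : M => (1 : ℝ)) p = 0 := by
    simp [dirDeriv, mvfderiv]
  rw [hc, h0, S.inner_xi, S.inner_xi_left] at h
  linarith

/-- The covariant derivative of `η` is metrically dual to that of `ξ`. -/
lemma dirDeriv_etaFun (X : Π p : M, TangentSpace 𝓘(ℝ, E) p) (hY : IsSmoothVectorField Y) (p : M) :
    dirDeriv X (S.etaFun Y) p
      = S.eta p (leviCivita Y p (X p)) + inner ℝ (leviCivita S.xi p (X p)) (Y p) := by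
  have h : S.etaFun Y = metricPairing S.xi Y := by
    ext q; rw [metricPairing_apply, S.inner_xi_left, etaFun]
  rw [h, dirDeriv_metricPairing X S.isSmooth_xi hY, S.inner_xi_left, add_comm]

lemma dEta_eq (hX : IsSmoothVectorField X) (hY : IsSmoothVectorField Y) (p : M) :
    S.dEta X Y p
      = inner ℝ (leviCivita S.xi p (X p)) (Y p) - inner ℝ (leviCivita S.xi p (Y p)) (X p) := by
  rw [dEta, dirDeriv_etaFun X hY, dirDeriv_etaFun Y hX, etaFun, mlieBracket_eq_leviCivita hX hY,
    map_sub]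
  ring

lemma lieDerivMetric_eq (hX : IsSmoothVectorField X) (hY : IsSmoothVectorField Y) (p : M) :
    S.lieDerivMetric X Y p
      = inner ℝ (leviCivita S.xi p (X p)) (Y p) + inner ℝ (leviCivita S.xi p (Y p)) (X p) := by
  rw [lieDerivMetric, dirDeriv_metricPairing _ hX hY, metricPairing_apply, metricPairing_apply,
    mlieBracket_eq_leviCivita S.isSmooth_xi hX, mlieBracket_eq_leviCivita S.isSmooth_xi hY,
    inner_sub_left, inner_sub_right, real_inner_comm (X p) (leviCivita S.xi p (Y p))]
  ring

/-- `N` is the alternating part of the tensor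
`(x, y) ↦ 2 ((∇_{φx} φ) y - φ (∇_x φ) y - (∇_x η)(y) ξ)`. -/
lemma nijenhuis_eq (hX : IsSmoothVectorField X) (hY : IsSmoothVectorField Y) (p : M) :
    S.nijenhuis X Y p
      = S.nablaPhi (S.phiField X) Y p - S.phi p (S.nablaPhi X Y p)
        - (S.nablaPhi (S.phiField Y) X p - S.phi p (S.nablaPhi Y X p))
        - (inner ℝ (leviCivita S.xi p (X p)) (Y p)
            - inner ℝ (leviCivita S.xi p (Y p)) (X p)) • S.xi p := by
  rw [nijenhuis, dEta_eq hX hY, mlieBracket_eq_leviCivita hX hY,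
    mlieBracket_eq_leviCivita (isSmooth_phiField hX) (isSmooth_phiField hY),
    mlieBracket_eq_leviCivita (isSmooth_phiField hX) hY,
    mlieBracket_eq_leviCivita hX (isSmooth_phiField hY)]
  simp only [nablaPhi, map_sub]
  abel

/-- `N̂` is the symmetric part of the tensor
`(x, y) ↦ 2 ((∇_{φx} φ) y - φ (∇_x φ) y - (∇_x η)(y) ξ)`. -/
lemma assocNijenhuis_eq (hX : IsSmoothVectorField X) (hY : IsSmoothVectorField Y) (p : M) :
    S.assocNijenhuis X Y p
      = S.nablaPhi (S.phiField X) Y p - S.phi p (S.nablaPhi X Y p)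
        + (S.nablaPhi (S.phiField Y) X p - S.phi p (S.nablaPhi Y X p))
        - (inner ℝ (leviCivita S.xi p (X p)) (Y p)
            + inner ℝ (leviCivita S.xi p (Y p)) (X p)) • S.xi p := by
  rw [assocNijenhuis, lieDerivMetric_eq hX hY]
  simp only [nablaPhi, symBracket, map_sub, map_add]
  abel

/-- Since `φ` is self-adjoint, so is `∇_X φ`. -/
lemma F_comm (X : Π p : M, TangentSpace 𝓘(ℝ, E) p) (hY : IsSmoothVectorField Y)
    (hZ : IsSmoothVectorField Z) (p : M) : S.F X Y Z p = S.F X Z Y p := by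
  have h : metricPairing (S.phiField Y) Z = metricPairing (S.phiField Z) Y := by
    ext q
    rw [metricPairing_apply, metricPairing_apply, phiField, phiField, S.inner_phi_left,
      real_inner_comm]
  have key (A B : Π p : M, TangentSpace 𝓘(ℝ, E) p) : S.F X A B p
      = inner ℝ (leviCivita (S.phiField A) p (X p)) (B p)
        - inner ℝ (S.phiField B p) (leviCivita A p (X p)) := by
    rw [F, nablaPhi, inner_sub_left, S.inner_phi_left, real_inner_comm (S.phi p (B p)), phiField]
  have h1 := dirDeriv_metricPairing X (isSmooth_phiField (S := S) hY) hZ p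
  have h2 := dirDeriv_metricPairing X (isSmooth_phiField (S := S) hZ) hY p
  rw [h, h2] at h1
  rw [key, key]
  linarith

/-- On horizontal fields `∇_X φ` anticommutes with `φ` up to a multiple of `ξ`. -/
lemma F_phiField (X : Π p : M, TangentSpace 𝓘(ℝ, E) p) (hY : S.IsSmoothHorizontal Y)
    (hZ : S.IsSmoothHorizontal Z) (p : M) :
    S.F X (S.phiField Y) Z p = -S.F X Y (S.phiField Z) p := by
  rw [F, F, phiField.eq_1 S Z, ← S.inner_phi_left, nablaPhi, nablaPhi, hY.phiField_phiField,
    map_sub, S.phi_phi]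
  simp only [inner_sub_left, real_inner_smul_left, S.inner_xi_left, hZ.2 p]
  ring

/-- `∇_X φ` is tensorial along the splitting of a field into its horizontal and vertical parts:
the derivative of `η(Y)` drops out because `φ ξ = 0`. -/
lemma nablaPhi_eq_horPart_add (X : Π p : M, TangentSpace 𝓘(ℝ, E) p) (hY : IsSmoothVectorField Y)
    (p : M) :
    S.nablaPhi X Y p = S.nablaPhi X (S.horPart Y) p + S.eta p (Y p) • S.nablaPhi X S.xi p := by
  have hsm := (isSmoothHorizontal_horPart (S := S) hY).1.mdiffAt p
  have hη := ((contMDiff_etaFun (S := S) hY) p).mdifferentiableAt (by simp)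
  have hξ := (S.isSmooth_xi).mdiffAt p
  have hphi : S.phiField Y = S.phiField (S.horPart Y) := by
    ext1 q; simp [phiField, horPart_apply, S.phi_xi]
  have hdec : Y = S.horPart Y + S.etaFun Y • S.xi := by simp [horPart]
  have hcov := (leviCivita (E := E) (M := M)).isCovariantDerivativeOnUniv
  have h : leviCivita Y p = leviCivita (S.horPart Y) p + (S.etaFun Y p • leviCivita S.xi p
      + (mvfderiv 𝓘(ℝ, E) (S.etaFun Y) p).smulRight (S.xi p)) := by
    conv_lhs => rw [hdec]
    rw [← hcov.leibniz hξ hη]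
    exact hcov.add hsm (hη.smul_section hξ)
  rw [nablaPhi_xi, nablaPhi, nablaPhi, hphi, h]
  simp [etaFun, S.phi_xi]
  abel

lemma F_eq_horPart_left (X Y Z : Π p : M, TangentSpace 𝓘(ℝ, E) p) (p : M) :
    S.F X Y Z p = S.F (S.horPart X) Y Z p + S.eta p (X p) * S.F S.xi Y Z p := by
  simp only [F, nablaPhi, horPart_apply, map_sub, map_smul, inner_sub_left, real_inner_smul_left]
  ring

lemma F_eq_horPart_middle (X : Π p : M, TangentSpace 𝓘(ℝ, E) p) (hY : IsSmoothVectorField Y)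
    (Z : Π p : M, TangentSpace 𝓘(ℝ, E) p) (p : M) :
    S.F X Y Z p = S.F X (S.horPart Y) Z p + S.eta p (Y p) * S.F X S.xi Z p := by
  rw [F, nablaPhi_eq_horPart_add X hY, inner_add_left, real_inner_smul_left, F, F]

lemma F_eq_horPart_right (X Y Z : Π p : M, TangentSpace 𝓘(ℝ, E) p) (p : M) :
    S.F X Y Z p = S.F X Y (S.horPart Z) p + S.eta p (Z p) * S.F X Y S.xi p := by
  simp only [F, horPart_apply, inner_sub_right, real_inner_smul_right]
  ring

lemma F_xi_xi (X : Π p : M, TangentSpace 𝓘(ℝ, E) p) (p : M) : S.F X S.xi S.xi p = 0 := by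
  rw [F, nablaPhi_xi, inner_neg_left, S.inner_xi, S.eta_phi, neg_zero]

/-! ### The para-Sasaki-like condition and the formula for `∇φ` -/

/-- Splitting all three arguments into horizontal and vertical parts, the four components
prescribed by the para-Sasaki-like condition determine `F`. -/
lemma IsParaSasakiLike.nablaPhi_eq [T2Space M] (h : S.IsParaSasakiLike)
    (hX : IsSmoothVectorField X) (hY : IsSmoothVectorField Y) (p : M) :
    S.nablaPhi X Y p
      = -inner ℝ (S.phi p (X p)) (S.phi p (Y p)) • S.xi p
        - S.eta p (Y p) • S.phi p (S.phi p (X p)) := by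
  refine ext_inner_right ℝ fun w => ?_
  obtain ⟨Z, hZ, rfl⟩ := exists_isSmoothVectorField_eq w
  have hX' := isSmoothHorizontal_horPart (S := S) hX
  have hY' := isSmoothHorizontal_horPart (S := S) hY
  have hZ' := isSmoothHorizontal_horPart (S := S) hZ
  obtain ⟨a1, a2, -, a4⟩ := h _ _ _ hX' hY' hZ' p
  obtain ⟨-, -, b3, b4⟩ := h _ _ _ hX' hZ' hY' p
  obtain ⟨-, -, c3, -⟩ := h _ _ _ hX' hY' hZ' p
  change S.F X Y Z p = _
  rw [F_eq_horPart_middle X hY, F_eq_horPart_left X (S.horPart Y), F_eq_horPart_left X S.xi,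
    F_eq_horPart_right _ (S.horPart Y) Z, F_eq_horPart_right _ S.xi Z,
    F_eq_horPart_right S.xi (S.horPart Y) Z, F_eq_horPart_right S.xi S.xi Z,
    F_xi_xi, F_xi_xi, F_comm S.xi hY'.1 S.isSmooth_xi, F_comm _ S.isSmooth_xi hZ'.1,
    a1, a2, a4, b3, b4, c3, inner_horPart, inner_horPart, S.inner_phi_phi, S.phi_phi]
  simp only [inner_sub_left, real_inner_smul_left, S.inner_xi_left]
  ring

lemma isParaSasakiLike_of_nablaPhi_eq
    (h : ∀ X Y : Π p : M, TangentSpace 𝓘(ℝ, E) p, IsSmoothVectorField X → IsSmoothVectorField Y →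
      ∀ p : M, S.nablaPhi X Y p
        = -inner ℝ (S.phi p (X p)) (S.phi p (Y p)) • S.xi p
          - S.eta p (Y p) • S.phi p (S.phi p (X p))) :
    S.IsParaSasakiLike := by
  intro X Y Z hX hY hZ p
  simp only [F, h X Y hX.1 hY.1 p, h S.xi Y S.isSmooth_xi hY.1 p,
    h S.xi S.xi S.isSmooth_xi S.isSmooth_xi p, S.phi_xi, S.inner_phi_phi, inner_sub_left,
    real_inner_smul_left, S.inner_xi_left, hX.2 p, hY.2 p, hZ.2 p, S.eta_xi, map_zero,
    inner_zero_left]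
  simp

/-- If `(∇_x φ) y = -g(φx, φy) ξ - η(y) φ² x`, then `∇_x ξ = φ x`. -/
lemma leviCivita_xi_eq_phi {p : M}
    (h : S.nablaPhi X S.xi p
        = -inner ℝ (S.phi p (X p)) (S.phi p (S.xi p)) • S.xi p
          - S.eta p (S.xi p) • S.phi p (S.phi p (X p))) :
    leviCivita S.xi p (X p) = S.phi p (X p) := by
  rw [nablaPhi_xi, S.phi_xi, inner_zero_right, S.eta_xi] at h
  have h' := congrArg (S.phi p) h
  simpa [S.phi_phi, eta_leviCivita_xi, S.eta_phi, S.phi_xi] using h'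

lemma nijenhuis_of_nablaPhi_eq
    (h : ∀ X Y : Π p : M, TangentSpace 𝓘(ℝ, E) p, IsSmoothVectorField X → IsSmoothVectorField Y →
      ∀ p : M, S.nablaPhi X Y p
        = -inner ℝ (S.phi p (X p)) (S.phi p (Y p)) • S.xi p
          - S.eta p (Y p) • S.phi p (S.phi p (X p)))
    (hX : IsSmoothVectorField X) (hY : IsSmoothVectorField Y) (p : M) :
    S.nijenhuis X Y p = 0 ∧
      S.assocNijenhuis X Y p
        = (-4 * (S.assocMetric X Y p - S.eta p (X p) * S.eta p (Y p))) • S.xi p := by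
  have hξX := leviCivita_xi_eq_phi (h X S.xi hX S.isSmooth_xi p)
  have hξY := leviCivita_xi_eq_phi (h Y S.xi hY S.isSmooth_xi p)
  have hc : inner ℝ (S.phi p (Y p)) (X p) = inner ℝ (S.phi p (X p)) (Y p) := by
    rw [S.inner_phi_left, real_inner_comm]
  have hc' : inner ℝ (X p) (S.phi p (Y p)) = inner ℝ (S.phi p (X p)) (Y p) :=
    (S.inner_phi_left _ _).symm
  have key (A B : Π p : M, TangentSpace 𝓘(ℝ, E) p) (hA : IsSmoothVectorField A)
      (hB : IsSmoothVectorField B) :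
      S.nablaPhi (S.phiField A) B p - S.phi p (S.nablaPhi A B p)
        = -inner ℝ (S.phi p (A p)) (B p) • S.xi p := by
    rw [h _ _ (isSmooth_phiField hA) hB, h _ _ hA hB, phiField, S.inner_phi_phi, S.eta_phi]
    simp [S.phi_xi]
  rw [nijenhuis_eq hX hY, assocNijenhuis_eq hX hY, key X Y hX hY, key Y X hY hX, hξX, hξY, hc,
    assocMetric, phiField, etaFun, etaFun, hc']
  constructor <;> module

/-! ### Recovering `F` from the Nijenhuis tensors -/

/-- What the conditions on `N` and `N̂` say about `F`: their sum is twice the tensor `(x, y) ↦ (∇_{φx} φ) y - φ (∇_x φ) y - (∇_x η)(y) ξ`, of which they are the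
alternating and symmetric parts. -/
lemma F_phiField_left_of_nijenhuis (hX : IsSmoothVectorField X) (hY : IsSmoothVectorField Y)
    (Z : Π p : M, TangentSpace 𝓘(ℝ, E) p) {p : M} (hN : S.nijenhuis X Y p = 0)
    (hN' : S.assocNijenhuis X Y p
      = (-4 * (S.assocMetric X Y p - S.eta p (X p) * S.eta p (Y p))) • S.xi p) :
    S.F (S.phiField X) Y Z p = S.F X Y (S.phiField Z) p
      + (inner ℝ (leviCivita S.xi p (X p)) (Y p) - 2 * inner ℝ (X p) (S.phi p (Y p)))
        * S.eta p (Z p) := by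
  rw [nijenhuis_eq hX hY] at hN
  rw [assocNijenhuis_eq hX hY, assocMetric, phiField, etaFun, etaFun] at hN'
  have h1 := congrArg (fun v => inner ℝ v (Z p)) hN
  have h2 := congrArg (fun v => inner ℝ v (Z p)) hN'
  simp only [inner_sub_left, inner_add_left, real_inner_smul_left, S.inner_xi_left,
    S.inner_phi_left _ (Z p), inner_zero_left] at h1 h2
  simp only [F, phiField]
  linarith

lemma isParaSasakiLike_of_nijenhuis
    (h : ∀ X Y : Π p : M, TangentSpace 𝓘(ℝ, E) p, IsSmoothVectorField X → IsSmoothVectorField Y →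
      ∀ p : M, S.nijenhuis X Y p = 0 ∧
        S.assocNijenhuis X Y p
          = (-4 * (S.assocMetric X Y p - S.eta p (X p) * S.eta p (Y p))) • S.xi p) :
    S.IsParaSasakiLike := by
  intro X Y Z hX hY hZ p
  have key (A B C : Π p : M, TangentSpace 𝓘(ℝ, E) p) (hA : IsSmoothVectorField A)
      (hB : IsSmoothVectorField B) :=
    F_phiField_left_of_nijenhuis hA hB C (h A B hA hB p).1 (h A B hA hB p).2
  have hξ := S.isSmooth_xi
  have hφY := hY.phiField
  have hφZ := hZ.phiField
  have hF0 (A B : Π p : M, TangentSpace 𝓘(ℝ, E) p) : S.F (S.phiField S.xi) A B p = 0 := by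
    simp [F, nablaPhi, phiField_xi]
  -- `F (x, ξ, z)` in terms of `∇_x ξ`.
  have hFξ (A B : Π p : M, TangentSpace 𝓘(ℝ, E) p) :
      S.F A S.xi B p = -inner ℝ (leviCivita S.xi p (A p)) (S.phiField B p) := by
    rw [F, nablaPhi_xi, inner_neg_left, S.inner_phi_left, phiField]
  -- The integral curves of `ξ` are geodesics.
  have hgeo (B : Π p : M, TangentSpace 𝓘(ℝ, E) p) (hB : IsSmoothVectorField B) :
      inner ℝ (leviCivita S.xi p (S.xi p)) (B p) = 0 := by
    have := key S.xi B S.xi hξ hB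
    rw [hF0, phiField_xi, S.eta_xi, S.inner_xi_left, S.eta_phi] at this
    simpa [F] using this.symm
  refine ⟨?_, ?_, ?_, ?_⟩
  · -- `F (φx, y, φz) = F (x, y, z)`, while `F (φx, φz, y) = F (x, φz, φy) = -F (x, z, y)`.
    have e1 := key X Y (S.phiField Z) hX.1 hY.1
    have e2 := key X (S.phiField Z) Y hX.1 hφZ.1
    rw [hZ.phiField_phiField, hφZ.2 p, mul_zero, add_zero] at e1
    rw [hY.2 p, mul_zero, add_zero, F_phiField X hZ hφY, hY.phiField_phiField,
      F_comm _ hφZ.1 hY.1, e1, F_comm X hZ.1 hY.1] at e2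
    linarith
  · have e := key S.xi Y (S.phiField Z) hξ hY.1
    rw [hF0, hZ.phiField_phiField, hφZ.2 p, mul_zero, add_zero] at e
    exact e.symm
  · rw [hFξ, hgeo _ hφZ.1, neg_zero]
  · -- Two expressions for `F (φx, φy, ξ)` give `g(∇_x ξ, φy) = g(x, y)`.
    have e1 := key X (S.phiField Y) S.xi hX.1 hφY.1
    have e2 := key X S.xi (S.phiField Y) hX.1 hξ
    rw [F_comm _ hφY.1 hξ, e2, hφY.2 p, hY.phiField_phiField, phiField_xi, S.eta_xi] at e1
    have hYY : S.phi p (S.phiField Y p) = Y p := congrFun hY.phiField_phiField p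
    have h0 : S.F X (S.phiField Y) 0 p = 0 := by simp [F]
    rw [hFξ, hYY, h0] at e1
    rw [F_comm X hY.1 hξ, hFξ]
    linarith

end CovariantDerivatives

end ParacontactParacomplexStructure

theorem theorem2p2
    {E : Type*} [NormedAddCommGroup E] [NormedSpace ℝ E] [FiniteDimensional ℝ E]
    {M : Type*} [TopologicalSpace M] [T2Space M] [ChartedSpace E M] [IsManifold 𝓘(ℝ, E) ∞ M]
    [RiemannianBundle (fun p : M => TangentSpace 𝓘(ℝ, E) p)]
    [IsContMDiffRiemannianBundle 𝓘(ℝ, E) ∞ E (fun p : M => TangentSpace 𝓘(ℝ, E) p)]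
    (n : ℕ) (hdim : Module.finrank ℝ E = 2 * n + 1)
    (S : ParacontactParacomplexStructure E M n) :
    List.TFAE [
      S.IsParaSasakiLike,
      ∀ X Y : Π p : M, TangentSpace 𝓘(ℝ, E) p,
        IsSmoothVectorField X → IsSmoothVectorField Y → ∀ p : M,
          S.nablaPhi X Y p
              = -inner ℝ (X p) (Y p) • S.xi p - S.eta p (Y p) • X p
                + (2 * S.eta p (X p) * S.eta p (Y p)) • S.xi p ∧
          S.nablaPhi X Y p
              = -inner ℝ (S.phi p (X p)) (S.phi p (Y p)) • S.xi p
                - S.eta p (Y p) • S.phi p (S.phi p (X p)),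
      ∀ X Y : Π p : M, TangentSpace 𝓘(ℝ, E) p,
        IsSmoothVectorField X → IsSmoothVectorField Y → ∀ p : M,
          S.nijenhuis X Y p = 0 ∧
          S.assocNijenhuis X Y p
              = (-4 * (S.assocMetric X Y p - S.eta p (X p) * S.eta p (Y p))) • S.xi p] := by
  -- The two expressions for `(∇_x φ) y` agree identically.
  have key (X Y : Π p : M, TangentSpace 𝓘(ℝ, E) p) (p : M) :
      -inner ℝ (X p) (Y p) • S.xi p - S.eta p (Y p) • X p
          + (2 * S.eta p (X p) * S.eta p (Y p)) • S.xi p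
        = -inner ℝ (S.phi p (X p)) (S.phi p (Y p)) • S.xi p
          - S.eta p (Y p) • S.phi p (S.phi p (X p)) := by
    rw [S.inner_phi_phi, S.phi_phi]
    module
  simp only [key, and_self]
  tfae_have 1 → 2 := fun h X Y hX hY p => h.nablaPhi_eq hX hY p
  tfae_have 2 → 3 := fun h X Y hX hY p =>
    ParacontactParacomplexStructure.nijenhuis_of_nablaPhi_eq h hX hY p
  tfae_have 3 → 1 := ParacontactParacomplexStructure.isParaSasakiLike_of_nijenhuis
  tfae_finish
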